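/- A metric space $(X,d)$ is called a Banakh space if for every point $c\in X$ and every $s\in d[X^2]:=\{d(x,y):x,y\in X\}$ there are points $x,y\in X$ such that $\{z\in X:d(z,c)=s\}=\{x,y\}$ and $d(x,y)=2s$. Let $a,b$ be points of a Banakh space $X$, let $r:=d(a,b)$, $\mathbb Qr:=\{qr:q\in\mathbb Q\}$ and $M_r:=d[X^2]\cap\mathbb Qr$, and put $M_r-M_r:=\{u-v:u,v\in M_r\}$ and $\pm M_r:=M_r\cup(-M_r)$. For $x\in X$ let $S(x;\mathbb Qr):=\{y\in X:d(x,y)\in\mathbb Qr\}$, and let $S^{\pm}(a;\mathbb Qr):=\bigcup_{y\in S(a;\mathbb Qr)}S(y;\mathbb Qr)$ be the $\mathbb Qr$-hypersphere around $a$. Then $M_r-M_r$ is a subgroup of $\mathbb Qr$, and there exists a unique bijective function $\ell:M_r-M_r\to S^{\pm}(a;\mathbb Qr)$ such that $\ell(0)=a$, $\ell(r)=b$, $\ell[\pm M_r]=S(a;\mathbb Qr)$, and for all $s,t\in M_r-M_r$ the following two conditions hold: (1) $|s-t|\le d(\ell(s),\ell(t))\le\inf\{u+v:u,v\in M_r,\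 |t-s|=u-v\}$; (2) $d(\ell(s),\ell(t))=|s-t|$ if and only if $|s-t|\in M_r$, if and only if $d(\ell(s),\ell(t))\in\mathbb Qr$. -/

import Mathlib

open scoped Pointwise

namespace Banakh

/-- The set of distances `d[X²] = {d(x,y) : x, y ∈ X}`. -/
def distSet (X : Type*) [MetricSpace X] : Set ℝ :=
  {s | ∃ x y : X, dist x y = s}

/-- A metric space is a Banakh space if for all `c ∈ X` and `s ∈ d[X²]` the sphere
`S(c;s) = {x : d(x,c) = s}` is of the form `{x, y}` with `d(x,y) = 2s`. -/
def IsBanakh (X : Type*) [MetricSpace X] : Prop :=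
  ∀ c : X, ∀ s ∈ distSet X, ∃ x y : X, Metric.sphere c s = {x, y} ∧ dist x y = 2 * s

/-- The set `ℚr = {q * r : q ∈ ℚ}` of rational multiples of a real number `r`. -/
def ratMultiples (r : ℝ) : Set ℝ :=
  {s | ∃ q : ℚ, s = (q : ℝ) * r}

/-- The `D`-sphere `S(x;D) = {y : d(x,y) ∈ D}` around `x`. -/
def dSphere {X : Type*} [MetricSpace X] (x : X) (D : Set ℝ) : Set X :=
  {y | dist x y ∈ D}

/-- The `ℚr`-hypersphere `S^±(x;ℚr)`, the union of `S(y;ℚr)` over all `y ∈ S(x;ℚr)`. -/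
def hypersphere {X : Type*} [MetricSpace X] (x : X) (r : ℝ) : Set X :=
  ⋃ y ∈ dSphere x (ratMultiples r), dSphere y (ratMultiples r)

/-- The set `M_r = d[X²] ∩ ℚr`. -/
def ratDist (X : Type*) [MetricSpace X] (r : ℝ) : Set ℝ :=
  distSet X ∩ ratMultiples r

/-- The set of differences `M_r - M_r = {u - v : u, v ∈ M_r}`. -/
def ratDiff (X : Type*) [MetricSpace X] (r : ℝ) : Set ℝ :=
  ratDist X r - ratDist X r

theorem zero_mem_ratDist {X : Type*} [MetricSpace X] (a : X) (r : ℝ) :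
    (0 : ℝ) ∈ ratDist X r :=
  ⟨⟨a, a, dist_self a⟩, ⟨0, by simp⟩⟩

theorem zero_mem_ratDiff {X : Type*} [MetricSpace X] (a : X) (r : ℝ) :
    (0 : ℝ) ∈ ratDiff X r :=
  ⟨0, zero_mem_ratDist a r, 0, zero_mem_ratDist a r, sub_zero 0⟩

theorem mem_ratDiff_of_eq_dist {X : Type*} [MetricSpace X] {a b : X} {r : ℝ}
    (hr : r = dist a b) : r ∈ ratDiff X r :=
  ⟨r, ⟨⟨a, b, hr.symm⟩, ⟨1, by simp⟩⟩, 0, zero_mem_ratDist a r, sub_zero r⟩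

end Banakh

/-!
Reflecting repeatedly at the last point reached extends any two points of a Banakh space to an
isometric copy of `s • ℤ`. Comparing such lines of commensurable steps at a common multiple of the
steps shows that segments can be prolonged by any commensurable distance, that points between two
given points exist and are unique, and that a triangle with commensurable sides is degenerate.

Fix `r = d(a, b)`. The sphere `S(a; ℚr)` consists of two opposite rays `f` and `g` issuing from `a`,
with `b` on `f`, and the point of coordinate `u - v` is the unique one at distance `v` from `f u`
and `u` from `g v`. This coordinate map is a *chart*: it preserves the distances that lie in `M_r`.
All the remaining assertions, uniqueness included, hold for every chart.
-/

namespace Banakh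

variable {X : Type*} [MetricSpace X]

section Antipodes

theorem dist_mem_distSet (x y : X) : dist x y ∈ distSet X := ⟨x, y, rfl⟩

theorem IsBanakh.exists_dist_eq_iff (hX : IsBanakh X) (c : X) {s : ℝ} (hs : s ∈ distSet X) :
    ∃ p q : X, (∀ z, dist c z = s ↔ z = p ∨ z = q) ∧ dist p q = 2 * s := by
  obtain ⟨p, q, hsphere, hpq⟩ := hX c s hs
  refine ⟨p, q, fun z => ?_, hpq⟩
  rw [← Metric.mem_sphere', hsphere, Set.mem_insert_iff, Set.mem_singleton_iff]

theorem IsBanakh.eq_or_dist_eq (hX : IsBanakh X) {c x y : X} {s : ℝ} (hx : dist c x = s)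
    (hy : dist c y = s) : x = y ∨ dist x y = 2 * s := by
  obtain ⟨p, q, hmem, hpq⟩ := hX.exists_dist_eq_iff c ⟨c, x, hx⟩
  rcases (hmem x).1 hx with rfl | rfl <;> rcases (hmem y).1 hy with rfl | rfl
  · exact Or.inl rfl
  · exact Or.inr hpq
  · exact Or.inr (by rw [dist_comm, hpq])
  · exact Or.inl rfl

theorem IsBanakh.eq_or_eq_of_antipodal (hX : IsBanakh X) {c x y z : X} {s : ℝ}
    (hx : dist c x = s) (hy : dist c y = s) (hxy : dist x y = 2 * s) (hz : dist c z = s) :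
    z = x ∨ z = y := by
  obtain ⟨p, q, hmem, hpq⟩ := hX.exists_dist_eq_iff c ⟨c, x, hx⟩
  rcases eq_or_ne x y with rfl | hne
  · have hpq' : p = q := dist_eq_zero.1 (by rw [hpq, ← hxy, dist_self])
    grind
  · grind

theorem IsBanakh.exists_antipode (hX : IsBanakh X) (c x : X) :
    ∃ y, dist c y = dist c x ∧ dist x y = 2 * dist c x := by
  obtain ⟨p, q, hmem, hpq⟩ := hX.exists_dist_eq_iff c (dist_mem_distSet c x)
  rcases (hmem x).1 rfl with rfl | rfl
  · exact ⟨q, (hmem q).2 (Or.inr rfl), hpq⟩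
  · exact ⟨p, (hmem p).2 (Or.inl rfl), by rw [dist_comm, hpq]⟩

/-- The reflection of `x` at `c`: the point opposite to `x` on the sphere around `c` through `x`. -/
noncomputable def IsBanakh.antipode (hX : IsBanakh X) (c x : X) : X :=
  (hX.exists_antipode c x).choose

theorem IsBanakh.dist_center_antipode (hX : IsBanakh X) (c x : X) :
    dist c (hX.antipode c x) = dist c x :=
  (hX.exists_antipode c x).choose_spec.1

theorem IsBanakh.dist_antipode (hX : IsBanakh X) (c x : X) :
    dist x (hX.antipode c x) = 2 * dist c x :=
  (hX.exists_antipode c x).choose_spec.2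

theorem IsBanakh.eq_or_eq_antipode (hX : IsBanakh X) {c x y : X} (hy : dist c y = dist c x) :
    y = x ∨ y = hX.antipode c x :=
  hX.eq_or_eq_of_antipodal rfl (hX.dist_center_antipode c x) (hX.dist_antipode c x) hy

theorem IsBanakh.eq_antipode (hX : IsBanakh X) {c x y : X} (hy : dist c y = dist c x)
    (hxy : dist x y = 2 * dist c x) : y = hX.antipode c x := by
  rcases hX.eq_or_eq_antipode hy with rfl | h
  · rw [← dist_eq_zero, hX.dist_antipode, ← hxy, dist_self]
  · exact h

theorem IsBanakh.antipode_antipode (hX : IsBanakh X) (c x : X) :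
    hX.antipode c (hX.antipode c x) = x :=
  (hX.eq_antipode (hX.dist_center_antipode c x).symm
    (by rw [dist_comm, hX.dist_antipode, hX.dist_center_antipode])).symm

end Antipodes

section Lines

/-- `x` is an isometric embedding of the lattice `s • ℤ ⊆ ℝ`, written as a function of the index. -/
def IsLine (s : ℝ) (x : ℤ → X) : Prop :=
  ∀ i j : ℤ, i ≤ j → dist (x i) (x j) = ((j : ℝ) - i) * s

/-- The permutation `(x, y) ↦ (y, z)` of `X × X`, where `z` is the reflection of `x` at `y`. Its
powers generate the line through two points in both directions. -/
noncomputable def IsBanakh.shift (hX : IsBanakh X) : Equiv.Perm (X × X) where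
  toFun p := (p.2, hX.antipode p.2 p.1)
  invFun p := (hX.antipode p.1 p.2, p.1)
  left_inv p := by simp only [hX.antipode_antipode]
  right_inv p := by simp only [hX.antipode_antipode]

theorem IsBanakh.exists_antipode_sequence (hX : IsBanakh X) (a b : X) :
    ∃ x : ℤ → X, x 0 = a ∧ x 1 = b ∧ ∀ i, x (i + 2) = hX.antipode (x (i + 1)) (x i) := by
  let p : ℤ → X × X := fun i => (hX.shift ^ i) (a, b)
  have p_succ (i : ℤ) : p (i + 1) = ((p i).2, hX.antipode (p i).2 (p i).1) := by
    simp only [p, add_comm i 1, zpow_add, zpow_one, Equiv.Perm.mul_apply]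
    rfl
  refine ⟨fun i => (p i).1, rfl, ?_, fun i => ?_⟩
  · exact congrArg Prod.fst (p_succ 0)
  · simp only [show i + 2 = i + 1 + 1 by ring, p_succ]

/-- The points lie in the order `p, l, c, l', q`: if `q` were equal to `p`, then `l` and `l'` would
have the same distance from the reflection of `p` at `c`. -/
theorem IsBanakh.dist_eq_add_two_mul (hX : IsBanakh X) {p l c l' q : X} {s t : ℝ} (hs : 0 < s)
    (hpl : dist p l = t) (hlc : dist l c = s) (hpc : dist p c = t + s) (hcl' : dist c l' = s)
    (hll' : dist l l' = 2 * s) (hl'q : dist l' q = t) (hcq : dist c q = t + s) :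
    dist p l' = t + 2 * s := by
  have ht : 0 ≤ t := hpl ▸ dist_nonneg
  have upper : dist p l' ≤ t + 2 * s := by linarith [dist_triangle p c l']
  obtain ⟨y, hcy, hpy⟩ := hX.exists_antipode c p
  rw [dist_comm c p, hpc] at hcy hpy
  rcases hX.eq_or_eq_of_antipodal (dist_comm c p ▸ hpc) hcy hpy hcq with rfl | rfl
  · have hyl : dist y l = t + 2 * s := by
      linarith [dist_triangle_left y l c, dist_triangle_right q y l, dist_comm c l]
    have hyl' : dist y l' = t + 2 * s := by
      linarith [dist_triangle_left y l' c, dist_triangle_right q y l', dist_comm l' q]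
    rcases hX.eq_or_dist_eq hyl hyl' with h | h
    · rw [h, dist_self] at hll'
      linarith
    · linarith
  · linarith [dist_triangle p l' q]

theorem IsBanakh.dist_eq_mul_of_dist_step (hX : IsBanakh X) {s : ℝ} (hs : 0 < s) {x : ℤ → X}
    (h1 : ∀ i, dist (x i) (x (i + 1)) = s) (h2 : ∀ i, dist (x i) (x (i + 2)) = 2 * s) (n : ℕ) :
    ∀ i, dist (x i) (x (i + n)) = n * s := by
  induction n using Nat.twoStepInduction with
  | zero => simp
  | one => simpa using h1
  | more n ih ih' =>
    intro i
    have hl'q := ih (i + n + 2)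
    have hcq := ih' (i + n + 1)
    rw [show i + n + 2 + n = i + n + 1 + (n + 1 : ℕ) by push_cast; ring] at hl'q
    have hcl' := h1 (i + n + 1)
    rw [show i + n + 1 + 1 = i + n + 2 by ring] at hcl'
    have hpc := ih' i
    rw [show i + (n + 1 : ℕ) = i + n + 1 by push_cast; ring] at hpc
    push_cast [add_one_mul] at hpc hcq
    rw [show i + (n + 2 : ℕ) = i + n + 2 by push_cast; ring]
    rw [hX.dist_eq_add_two_mul hs (ih i) (h1 _) hpc hcl' (h2 _) hl'q (by push_cast; exact hcq)]
    push_cast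
    ring

theorem IsBanakh.exists_isLine (hX : IsBanakh X) (a b : X) :
    ∃ x : ℤ → X, IsLine (dist a b) x ∧ x 0 = a ∧ x 1 = b := by
  rcases eq_or_ne a b with rfl | hab
  · exact ⟨fun _ => a, fun i j _ => by simp, rfl, rfl⟩
  obtain ⟨x, h0, h1, hx⟩ := hX.exists_antipode_sequence a b
  have step_eq (i : ℤ) : dist (x (i + 1)) (x (i + 2)) = dist (x i) (x (i + 1)) := by
    rw [hx, hX.dist_center_antipode, dist_comm]
  have step (i : ℤ) : dist (x i) (x (i + 1)) = dist a b := by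
    induction i using Int.induction_on with
    | zero => rw [zero_add, h0, h1]
    | succ n ih => rw [add_assoc, one_add_one_eq_two, step_eq, ih]
    | pred n ih => rw [← step_eq, ← ih]; ring_nf
  have two_step (i : ℤ) : dist (x i) (x (i + 2)) = 2 * dist a b := by
    rw [hx, hX.dist_antipode, dist_comm, step]
  refine ⟨x, fun i j hij => ?_, h0, h1⟩
  obtain ⟨n, rfl⟩ := Int.le.dest hij
  rw [hX.dist_eq_mul_of_dist_step (dist_pos.2 hab) step two_step]
  push_cast
  ring

theorem IsLine.eq_or_eq (hX : IsBanakh X) {s : ℝ} {x : ℤ → X} (hx : IsLine s x) {y : X} {k : ℕ}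
    (hy : dist (x 0) y = k * s) : y = x k ∨ y = x (-k) := by
  refine hX.eq_or_eq_of_antipodal ?_ ?_ ?_ hy
  · rw [hx _ _ (by omega)]
    simp
  · rw [dist_comm, hx _ _ (by omega)]
    simp
  · rw [dist_comm, hx _ _ (by omega)]
    push_cast
    ring

end Lines

section Commensurable

theorem IsBanakh.dist_eq_sub_or_add (hX : IsBanakh X) {c p e : X} {k : ℕ} (hk : 0 < k)
    (he : dist c e = k * dist c p) :
    dist p e = k * dist c p - dist c p ∨ dist p e = k * dist c p + dist c p := by
  obtain ⟨x, hx, rfl, hxp⟩ := hX.exists_isLine c p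
  rcases hx.eq_or_eq hX he with rfl | rfl
  · left
    rw [← hxp, hx 1 k (by omega), hxp]
    push_cast
    ring
  · right
    rw [← hxp, dist_comm, hx (-k) 1 (by omega), hxp]
    push_cast
    ring

theorem IsBanakh.exists_dist_eq_of_dist_eq_mul (hX : IsBanakh X) {p e : X} {w : ℝ}
    (hw : w ∈ distSet X) {k : ℕ} (hk : 0 < k) (he : dist p e = k * w) :
    ∃ q, dist p q = w ∧ dist q e = k * w - w := by
  obtain ⟨q, q', hmem, -⟩ := hX.exists_dist_eq_iff p hw
  obtain rfl := (hmem q).2 (Or.inl rfl)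
  obtain ⟨x, hx, rfl, rfl⟩ := hX.exists_isLine p q
  rcases hx.eq_or_eq hX he with rfl | rfl
  · refine ⟨x 1, rfl, ?_⟩
    rw [hx 1 k (by omega)]
    push_cast
    ring
  · refine ⟨x (-1), ?_, ?_⟩
    · rw [dist_comm, hx (-1) 0 (by omega)]
      simp
    · rw [dist_comm, hx (-k) (-1) (by omega)]
      push_cast
      ring

theorem IsBanakh.exists_prolongation_of_mul_eq (hX : IsBanakh X) {a p : X} {w : ℝ}
    (hw : w ∈ distSet X) {k l : ℕ} (hl : 0 < l) (hkl : k * dist a p = l * w) :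
    ∃ q, dist p q = w ∧ dist a q = dist a p + w := by
  obtain ⟨x, hx, hxa, hxp⟩ := hX.exists_isLine a p
  have hpe : dist p (x (1 + k)) = l * w := by
    rw [← hkl, ← hxp, hx _ _ (by omega), hxp]
    push_cast
    ring
  have hae : dist a (x (1 + k)) = dist a p + l * w := by
    rw [← hxa, hx _ _ (by omega), ← hkl, hxa]
    push_cast
    ring
  obtain ⟨q, hpq, hqe⟩ := hX.exists_dist_eq_of_dist_eq_mul hw hl hpe
  refine ⟨q, hpq, le_antisymm ?_ ?_⟩
  · linarith [dist_triangle a p q]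
  · linarith [dist_triangle a q (x (1 + k))]

theorem IsBanakh.dist_eq_add_or_eq_abs_sub_of_mul_eq (hX : IsBanakh X) {a p q : X} {k l m : ℕ}
    (hk : 0 < k) (hl : 0 < l) (hm : 0 < m) (hkl : k * dist a q = l * dist a p)
    (hkm : k * dist a q = m * dist q p) :
    dist p q = dist a p + dist a q ∨ dist p q = |dist a p - dist a q| := by
  obtain ⟨x, hx, hxa, hxq⟩ := hX.exists_isLine a q
  set t := dist a q
  have hae : dist a (x k) = k * t := by rw [← hxa, hx _ _ (by omega)]; simp
  have hqe : dist q (x k) = k * t - t := by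
    rw [← hxq, hx _ _ (by omega)]; push_cast; ring
  have hef : dist (x k) (x (k + 1)) = t := by rw [hx _ _ (by omega)]; simp
  have haf : dist a (x (k + 1)) = k * t + t := by
    rw [← hxa, hx _ _ (by omega)]; push_cast; ring
  have hqf : dist q (x (k + 1)) = k * t := by
    rw [← hxq, hx _ _ (by omega)]; push_cast; ring
  have hpq_le : dist p q ≤ dist a p + t := dist_triangle_left p q a
  rcases hX.dist_eq_sub_or_add hl (hae.trans hkl) with hpe | hpe
  · right
    have hpf : dist p (x (k + 1)) = k * t - dist a p + t := by
      linarith [dist_triangle p (x k) (x (k + 1)), dist_triangle a p (x (k + 1))]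
    rcases hX.dist_eq_sub_or_add hm (hqf.trans hkm) with h | h
    · rw [show dist p q = dist a p - t by linarith [dist_comm p q], eq_comm, abs_eq_self]
      linarith [dist_comm p q, dist_nonneg (x := p) (y := q)]
    · rw [show dist p q = -(dist a p - t) by linarith [dist_comm p q], eq_comm, abs_eq_neg_self]
      linarith [dist_comm p q, dist_nonneg (x := p) (y := q)]
  · left
    linarith [dist_triangle p q (x k)]

end Commensurable

section RationalDistances

variable {r : ℝ}

theorem add_mem_ratMultiples {u v : ℝ} (hu : u ∈ ratMultiples r) (hv : v ∈ ratMultiples r) :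
    u + v ∈ ratMultiples r := by
  obtain ⟨p, rfl⟩ := hu
  obtain ⟨q, rfl⟩ := hv
  exact ⟨p + q, by push_cast; ring⟩

theorem neg_mem_ratMultiples {u : ℝ} (hu : u ∈ ratMultiples r) : -u ∈ ratMultiples r := by
  obtain ⟨p, rfl⟩ := hu
  exact ⟨-p, by push_cast; ring⟩

theorem abs_mem_ratMultiples {u : ℝ} (hu : u ∈ ratMultiples r) : |u| ∈ ratMultiples r := by
  rcases abs_choice u with h | h <;> rw [h]
  exacts [hu, neg_mem_ratMultiples hu]

theorem ratDiff_subset_ratMultiples : ratDiff X r ⊆ ratMultiples r := by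
  rintro _ ⟨u, hu, v, hv, rfl⟩
  simpa only [sub_eq_add_neg] using add_mem_ratMultiples hu.2 (neg_mem_ratMultiples hv.2)

theorem nonneg_of_mem_ratDist {u : ℝ} (hu : u ∈ ratDist X r) : 0 ≤ u := by
  obtain ⟨⟨x, y, rfl⟩, -⟩ := hu
  exact dist_nonneg

theorem eq_zero_of_mem_ratDist_zero {u : ℝ} (hu : u ∈ ratDist X 0) : u = 0 := by
  obtain ⟨-, q, rfl⟩ := hu
  exact mul_zero _

theorem dist_mem_ratDist_self (a b : X) : dist a b ∈ ratDist X (dist a b) :=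
  ⟨dist_mem_distSet a b, 1, by simp⟩

theorem exists_nat_mul_eq_nat_mul {u v : ℝ} (hu : u ∈ ratMultiples r) (hv : v ∈ ratMultiples r)
    (hu0 : 0 < u) (hv0 : 0 < v) : ∃ k l : ℕ, 0 < k ∧ 0 < l ∧ k * u = l * v := by
  obtain ⟨c, hc⟩ : ∃ c : ℚ, u = c * v := by
    obtain ⟨p, rfl⟩ := hu
    obtain ⟨q, rfl⟩ := hv
    refine ⟨p / q, ?_⟩
    have hq : (q : ℝ) ≠ 0 := left_ne_zero_of_mul hv0.ne'
    push_cast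
    field_simp
  have hc0 : 0 < c := by exact_mod_cast pos_of_mul_pos_left (hc ▸ hu0) hv0.le
  lift c to ℚ≥0 using hc0.le
  refine ⟨c.den, c.num, c.den_pos, NNRat.num_pos.2 (by exact_mod_cast hc0), ?_⟩
  have hden : (c.den : ℝ) * c = c.num := by exact_mod_cast NNRat.den_mul_eq_num c
  rw [hc, ← hden, mul_assoc]
  norm_cast

theorem IsBanakh.exists_prolongation (hX : IsBanakh X) {a p : X} {w : ℝ}
    (hap : dist a p ∈ ratMultiples r) (hw : w ∈ ratDist X r) :
    ∃ q, dist p q = w ∧ dist a q = dist a p + w := by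
  rcases eq_or_ne a p with rfl | hne
  · obtain ⟨q, q', hmem, -⟩ := hX.exists_dist_eq_iff a hw.1
    have haq := (hmem q).2 (Or.inl rfl)
    exact ⟨q, haq, by rw [haq, dist_self, zero_add]⟩
  rcases (nonneg_of_mem_ratDist hw).eq_or_lt with rfl | hw0
  · exact ⟨p, dist_self p, (add_zero _).symm⟩
  obtain ⟨k, l, -, hl, hkl⟩ := exists_nat_mul_eq_nat_mul hap hw.2 (dist_pos.2 hne) hw0
  exact hX.exists_prolongation_of_mul_eq hw.1 hl hkl

theorem IsBanakh.add_mem_ratDist (hX : IsBanakh X) {u v : ℝ} (hu : u ∈ ratDist X r)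
    (hv : v ∈ ratDist X r) : u + v ∈ ratDist X r := by
  obtain ⟨⟨a, p, rfl⟩, hap⟩ := hu
  obtain ⟨q, -, haq⟩ := hX.exists_prolongation hap hv
  exact ⟨⟨a, q, haq⟩, add_mem_ratMultiples hap hv.2⟩

theorem IsBanakh.dist_eq_add_or_eq_abs_sub (hX : IsBanakh X) {a p q : X}
    (hap : dist a p ∈ ratMultiples r) (haq : dist a q ∈ ratMultiples r)
    (hpq : dist p q ∈ ratMultiples r) :
    dist p q = dist a p + dist a q ∨ dist p q = |dist a p - dist a q| := by
  rcases eq_or_ne a p with rfl | hne_ap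
  · exact Or.inl (by rw [dist_self, zero_add])
  rcases eq_or_ne a q with rfl | hne_aq
  · exact Or.inl (by rw [dist_self, add_zero, dist_comm])
  rcases eq_or_ne p q with rfl | hne_pq
  · exact Or.inr (by simp)
  obtain ⟨k, l, hk, hl, hkl⟩ :=
    exists_nat_mul_eq_nat_mul haq hap (dist_pos.2 hne_aq) (dist_pos.2 hne_ap)
  obtain ⟨k', m, hk', hm, hkm⟩ :=
    exists_nat_mul_eq_nat_mul haq hpq (dist_pos.2 hne_aq) (dist_pos.2 hne_pq)
  refine hX.dist_eq_add_or_eq_abs_sub_of_mul_eq (k := k * k') (l := k' * l) (m := k * m)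
    (by positivity) (by positivity) (by positivity) ?_ ?_
  · push_cast
    linear_combination (k' : ℝ) * hkl
  · rw [dist_comm q p]
    push_cast
    linear_combination (k : ℝ) * hkm

theorem IsBanakh.eq_of_between (hX : IsBanakh X) {p q x y : X} {u v : ℝ}
    (hpq : dist p q = u + v) (hpx : dist p x = u) (hxq : dist x q = v) (hpy : dist p y = u)
    (hyq : dist y q = v) : x = y := by
  rcases hX.eq_or_dist_eq hpx hpy with h | hxy
  · exact h
  rcases hX.eq_or_dist_eq (dist_comm q x ▸ hxq) (dist_comm q y ▸ hyq) with h | hxy'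
  · exact h
  obtain rfl : u = v := by linarith
  -- Neither `x` nor `y` can be the point beyond `p` as seen from `q`.
  obtain ⟨z, hpz, hqz⟩ := hX.exists_prolongation_of_mul_eq (k := 1) (l := 2) (a := q) (p := p)
    ⟨p, x, hpx⟩ two_pos (by rw [dist_comm, hpq]; push_cast; ring)
  rw [dist_comm q p, hpq] at hqz
  have hu : u = 0 := by
    rcases hX.eq_or_eq_of_antipodal hpx hpy hxy hpz with rfl | rfl <;>
      linarith [dist_comm q z]
  rw [← dist_eq_zero, hxy, hu, mul_zero]

theorem IsBanakh.exists_between (hX : IsBanakh X) {p q : X} {u v : ℝ} (hu : u ∈ ratDist X r)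
    (hv : v ∈ ratDist X r) (hpq : dist p q = u + v) : ∃ x, dist p x = u ∧ dist x q = v := by
  obtain ⟨x, x', hmem, hxx'⟩ := hX.exists_dist_eq_iff p hu.1
  have hpx := (hmem x).2 (Or.inl rfl)
  have hpx' := (hmem x').2 (Or.inr rfl)
  obtain ⟨y, hxy, hpy⟩ := hX.exists_prolongation (hpx ▸ hu.2) hv
  obtain ⟨y', hxy', hpy'⟩ := hX.exists_prolongation (hpx' ▸ hu.2) hv
  rw [hpx] at hpy
  rw [hpx'] at hpy'
  rcases hX.eq_or_dist_eq hpy hpy' with rfl | hyy'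
  · -- By uniqueness of the point between `p` and `y`, the sphere `S(p; u)` is a singleton.
    obtain rfl := hX.eq_of_between hpy hpx hxy hpx' hxy'
    obtain rfl : u = 0 := by linarith [dist_self x]
    exact ⟨p, dist_self p, by rw [hpq, zero_add]⟩
  · rcases hX.eq_or_eq_of_antipodal hpy hpy' hyy' hpq with rfl | rfl
    exacts [⟨x, hpx, hxy⟩, ⟨x', hpx', hxy'⟩]

theorem IsBanakh.add_mem_ratDiff (hX : IsBanakh X) {s t : ℝ} (hs : s ∈ ratDiff X r)
    (ht : t ∈ ratDiff X r) : s + t ∈ ratDiff X r := by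
  obtain ⟨u, hu, v, hv, rfl⟩ := hs
  obtain ⟨u', hu', v', hv', rfl⟩ := ht
  exact ⟨u + u', hX.add_mem_ratDist hu hu', v + v', hX.add_mem_ratDist hv hv', by ring⟩

theorem neg_mem_ratDiff {s : ℝ} (hs : s ∈ ratDiff X r) : -s ∈ ratDiff X r := by
  obtain ⟨u, hu, v, hv, rfl⟩ := hs
  exact ⟨v, hv, u, hu, (neg_sub u v).symm⟩

theorem IsBanakh.sub_mem_ratDiff (hX : IsBanakh X) {s t : ℝ} (hs : s ∈ ratDiff X r)
    (ht : t ∈ ratDiff X r) : s - t ∈ ratDiff X r :=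
  sub_eq_add_neg s t ▸ hX.add_mem_ratDiff hs (neg_mem_ratDiff ht)

/-- The subgroup `M_r - M_r` of `ℝ`. -/
def IsBanakh.ratDiffAddSubgroup [Nonempty X] (hX : IsBanakh X) (r : ℝ) : AddSubgroup ℝ where
  carrier := ratDiff X r
  add_mem' := hX.add_mem_ratDiff
  zero_mem' := zero_mem_ratDiff (Classical.arbitrary X) r
  neg_mem' := neg_mem_ratDiff

theorem ratDist_subset_ratDiff : ratDist X r ⊆ ratDiff X r := by
  intro u hu
  obtain ⟨x, -, -⟩ := hu.1
  exact ⟨u, hu, 0, zero_mem_ratDist x r, sub_zero u⟩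

theorem ratDist_union_neg_subset_ratDiff : ratDist X r ∪ -ratDist X r ⊆ ratDiff X r := by
  rintro t (ht | ht)
  · exact ratDist_subset_ratDiff ht
  · exact neg_neg t ▸ neg_mem_ratDiff (ratDist_subset_ratDiff ht)

theorem IsBanakh.exists_eq_add_eq_add (hX : IsBanakh X) {s t : ℝ} (hs : s ∈ ratDiff X r)
    (ht : t ∈ ratDiff X r) :
    ∃ c ∈ ratDiff X r, ∃ p ∈ ratDist X r, ∃ q ∈ ratDist X r, s = c + p ∧ t = c + q := by
  obtain ⟨u, hu, v, hv, rfl⟩ := hs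
  obtain ⟨u', hu', v', hv', rfl⟩ := ht
  exact ⟨-(v + v'), neg_mem_ratDiff (ratDist_subset_ratDiff (hX.add_mem_ratDist hv hv')),
    u + v', hX.add_mem_ratDist hu hv', u' + v, hX.add_mem_ratDist hu' hv, by ring, by ring⟩

end RationalDistances

section Rays

variable {r : ℝ} {f g : ℝ → X}

/-- `f` and `g` parametrize by `M_r` two opposite rays with the common origin `f 0 = g 0`. -/
def IsRays (r : ℝ) (f g : ℝ → X) : Prop :=
  ∀ u ∈ ratDist X r, ∀ v ∈ ratDist X r, dist (f u) (g v) = u + v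

theorem IsRays.symm (h : IsRays r f g) : IsRays r g f := fun u hu v hv => by
  rw [dist_comm, h v hv u hu, add_comm]

theorem IsBanakh.exists_isRays (hX : IsBanakh X) (a b : X) :
    ∃ f g : ℝ → X, IsRays (dist a b) f g ∧ f 0 = a ∧ f (dist a b) = b := by
  have hr := dist_mem_ratDist_self a b
  have prolong : ∀ v ∈ ratDist X (dist a b), ∃ y, dist a y = v ∧ dist b y = dist a b + v :=
    fun v hv => dist_comm b a ▸ hX.exists_prolongation (dist_comm a b ▸ hr.2) hv
  have : Nonempty X := ⟨a⟩
  choose! g hag hbg using prolong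
  let f u := hX.antipode a (g u)
  have haf : ∀ u ∈ ratDist X (dist a b), dist a (f u) = u := fun u hu => by
    rw [hX.dist_center_antipode, hag u hu]
  have eq_zero_or_eq_zero : ∀ u ∈ ratDist X (dist a b), ∀ v ∈ ratDist X (dist a b),
      dist (g u) (g v) = u + v → u = 0 ∨ v = 0 := fun u hu v hv huv => by
    have degenerate := hX.dist_eq_add_or_eq_abs_sub
      ((hbg u hu).symm ▸ add_mem_ratMultiples hr.2 hu.2)
      ((hbg v hv).symm ▸ add_mem_ratMultiples hr.2 hv.2) (huv ▸ add_mem_ratMultiples hu.2 hv.2)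
    rw [huv, hbg u hu, hbg v hv, add_sub_add_left_eq_sub] at degenerate
    rcases degenerate with hsum | hsub
    · have hr0 : dist a b = 0 := by linarith
      exact Or.inl (eq_zero_of_mem_ratDist_zero (hr0 ▸ hu))
    · grind
  refine ⟨f, g, fun u hu v hv => ?_, ?_, ?_⟩
  · have hgv : dist (g v) a = v := by rw [dist_comm, hag v hv]
    obtain ⟨z, haz, hgz⟩ := hX.exists_prolongation (hgv.symm ▸ hv.2) hu
    rw [hgv, add_comm] at hgz
    rcases hX.eq_or_eq_antipode (haz.trans (hag u hu).symm) with rfl | rfl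
    · rcases eq_zero_or_eq_zero u hu v hv (by rw [dist_comm, hgz]) with rfl | rfl
      · rw [← dist_eq_zero.1 (haf 0 hu), hag v hv, zero_add]
      · rw [dist_eq_zero.1 hgv, dist_comm, haf u hu, add_zero]
    · rw [dist_comm, hgz]
  · exact (dist_eq_zero.1 (haf 0 (zero_mem_ratDist a _))).symm
  · refine (hX.eq_antipode (hag _ hr).symm ?_).symm
    rw [dist_comm, hbg _ hr, hag _ hr, two_mul]

theorem IsRays.eq_or_eq (h : IsRays r f g) (hX : IsBanakh X) {u : ℝ} (hu : u ∈ ratDist X r)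
    {x : X} (hx : dist (f 0) x = u) : x = f u ∨ x = g u := by
  have h0 := zero_mem_ratDist x r
  have hfg : f 0 = g 0 := dist_eq_zero.1 (by rw [h 0 h0 0 h0, add_zero])
  refine hX.eq_or_eq_of_antipodal ?_ ?_ ?_ hx
  · rw [hfg, dist_comm, h u hu 0 h0, add_zero]
  · rw [h 0 h0 u hu, zero_add]
  · rw [h u hu u hu, two_mul]

theorem IsRays.dist_left_add (h : IsRays r f g) (hX : IsBanakh X) {u w : ℝ}
    (hu : u ∈ ratDist X r) (hw : w ∈ ratDist X r) : dist (f u) (f (u + w)) = w := by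
  have h0 := zero_mem_ratDist (f 0) r
  have hfg : f 0 = g 0 := dist_eq_zero.1 (by rw [h 0 h0 0 h0, add_zero])
  have huw := hX.add_mem_ratDist hu hw
  obtain ⟨x, hx, hxw⟩ := hX.exists_between (p := f 0) hu hw
    (by rw [hfg, dist_comm, h _ huw 0 h0, add_zero])
  rcases h.eq_or_eq hX hu hx with rfl | rfl
  · exact hxw
  · rw [dist_comm, h _ huw u hu] at hxw
    obtain rfl : u = 0 := by linarith [nonneg_of_mem_ratDist hu]
    rw [hfg, dist_comm, h _ huw 0 h0, add_zero, zero_add]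

/-- `x` is the point of coordinate `s` relative to the rays `f` and `g`: for every representation
`s = u - v` it lies between `f u` and `g v`, at distance `v` from the former. -/
def HasCoord (r : ℝ) (f g : ℝ → X) (x : X) (s : ℝ) : Prop :=
  ∀ u ∈ ratDist X r, ∀ v ∈ ratDist X r, u - v = s → dist (f u) x = v ∧ dist x (g v) = u

theorem IsRays.dist_add (h : IsRays r f g) (hX : IsBanakh X) {u v w : ℝ} (hu : u ∈ ratDist X r)
    (hv : v ∈ ratDist X r) (hw : w ∈ ratDist X r) {x : X} (hfx : dist (f u) x = v)
    (hxg : dist x (g v) = u) :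
    dist (f (u + w)) x = v + w ∧ dist x (g (v + w)) = u + w := by
  have hff := h.dist_left_add hX hu hw
  have hgg := h.symm.dist_left_add hX hv hw
  have hfg := h _ (hX.add_mem_ratDist hu hw) _ (hX.add_mem_ratDist hv hw)
  have upper_f := dist_triangle_left (f (u + w)) x (f u)
  have upper_g := dist_triangle x (g v) (g (v + w))
  have lower := dist_triangle (f (u + w)) x (g (v + w))
  constructor <;> linarith

theorem IsRays.exists_hasCoord (h : IsRays r f g) (hX : IsBanakh X) {s : ℝ}
    (hs : s ∈ ratDiff X r) : ∃ x, HasCoord r f g x s := by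
  have between : ∀ u ∈ ratDist X r, ∀ v ∈ ratDist X r, ∃ x, dist (f u) x = v ∧ dist x (g v) = u :=
    fun u hu v hv => hX.exists_between hv hu (by rw [h u hu v hv, add_comm])
  obtain ⟨u₀, hu₀, v₀, hv₀, rfl⟩ := hs
  obtain ⟨x, hfx, hxg⟩ := between u₀ hu₀ v₀ hv₀
  refine ⟨x, fun u hu v hv huv => ?_⟩
  obtain ⟨y, hfy, hyg⟩ := between u hu v hv
  obtain ⟨hfx', hxg'⟩ := h.dist_add hX hu₀ hv₀ hv hfx hxg
  obtain ⟨hfy', hyg'⟩ := h.dist_add hX hu hv hv₀ hfy hyg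
  have huv' : u + v₀ = u₀ + v := by
    change u - v = u₀ - v₀ at huv
    linarith
  rw [huv', add_comm v v₀] at hfy' hyg'
  have hfg := h _ (hX.add_mem_ratDist hu₀ hv) _ (hX.add_mem_ratDist hv₀ hv)
  obtain rfl := hX.eq_of_between (hfg.trans (add_comm _ _)) hfx' hxg' hfy' hyg'
  exact ⟨hfy, hyg⟩

theorem HasCoord.dist_eq (hX : IsBanakh X) (h : IsRays r f g) {x y : X} {s w : ℝ}
    (hs : s ∈ ratDiff X r) (hw : w ∈ ratDist X r) (hx : HasCoord r f g x s)
    (hy : HasCoord r f g y (s + w)) : dist x y = w := by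
  obtain ⟨u, hu, v, hv, rfl⟩ := hs
  have huw := hX.add_mem_ratDist hu hw
  obtain ⟨hfy, hyg⟩ := hy (u + w) huw v hv (add_sub_right_comm u w v)
  obtain ⟨hfx, hxg⟩ := hx u hu v hv rfl
  obtain ⟨hfx', -⟩ := h.dist_add hX hu hv hw hfx hxg
  obtain ⟨z, hgz, hzy⟩ := hX.exists_between hu hw (dist_comm y (g v) ▸ hyg)
  have hfz : dist (f (u + w)) z = v + w := by
    linarith [h _ huw v hv, dist_triangle_right (f (u + w)) z y,
      dist_triangle_right (f (u + w)) (g v) z]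
  have hfg : dist (f (u + w)) (g v) = v + w + u := by rw [h _ huw v hv]; ring
  rwa [hX.eq_of_between hfg hfx' hxg hfz (dist_comm z (g v) ▸ hgz)]

end Rays

section Charts

variable {r : ℝ} {L : ℝ → X}

/-- A parametrization by `M_r - M_r` that preserves the distances lying in `M_r`; its values outside
`M_r - M_r` are irrelevant. -/
def IsChart (r : ℝ) (L : ℝ → X) : Prop :=
  ∀ s ∈ ratDiff X r, ∀ t ∈ ratDiff X r, |s - t| ∈ ratDist X r → dist (L s) (L t) = |s - t|

theorem isChart_of_dist_add
    (hL : ∀ s ∈ ratDiff X r, ∀ w ∈ ratDist X r, dist (L s) (L (s + w)) = w) :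
    IsChart r L := by
  intro s hs t ht hst
  rcases le_total s t with hle | hle
  · simpa [abs_of_nonpos (sub_nonpos.2 hle)] using hL s hs _ hst
  · rw [dist_comm]
    simpa [abs_of_nonneg (sub_nonneg.2 hle)] using hL t ht _ hst

theorem IsBanakh.exists_isChart (hX : IsBanakh X) (a b : X) :
    ∃ L : ℝ → X, IsChart (dist a b) L ∧ L 0 = a ∧ L (dist a b) = b := by
  obtain ⟨f, g, h, rfl, hfb⟩ := hX.exists_isRays a b
  have : Nonempty X := ⟨b⟩
  have h0 := zero_mem_ratDist b (dist (f 0) b)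
  have coord : ∀ s ∈ ratDiff X (dist (f 0) b), ∃ x, HasCoord (dist (f 0) b) f g x s :=
    fun s hs => h.exists_hasCoord hX hs
  choose! L hL using coord
  have hLf : ∀ u ∈ ratDist X (dist (f 0) b), L u = f u := fun u hu =>
    (dist_eq_zero.1 (hL u (ratDist_subset_ratDiff hu) u hu 0 h0 (sub_zero u)).1).symm
  refine ⟨L, isChart_of_dist_add fun s hs w hw => ?_, hLf 0 h0, ?_⟩
  · exact (hL s hs).dist_eq hX h hs hw
      (hL _ (hX.add_mem_ratDiff hs (ratDist_subset_ratDiff hw)))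
  · rw [hLf _ (dist_mem_ratDist_self _ b), hfb]

theorem IsChart.dist_add (h : IsChart r L) (hX : IsBanakh X) {s u : ℝ} (hs : s ∈ ratDiff X r)
    (hu : u ∈ ratDist X r) : dist (L s) (L (s + u)) = u := by
  have hsu : |s - (s + u)| = u := by
    rw [sub_add_cancel_left, abs_neg, abs_of_nonneg (nonneg_of_mem_ratDist hu)]
  rw [h s hs _ (hX.add_mem_ratDiff hs (ratDist_subset_ratDiff hu)) (hsu.symm ▸ hu), hsu]

theorem IsChart.dist_sub (h : IsChart r L) (hX : IsBanakh X) {s u : ℝ} (hs : s ∈ ratDiff X r)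
    (hu : u ∈ ratDist X r) : dist (L s) (L (s - u)) = u := by
  rw [dist_comm]
  simpa only [sub_add_cancel] using
    h.dist_add hX (hX.sub_mem_ratDiff hs (ratDist_subset_ratDiff hu)) hu

theorem IsChart.dist_add_sub (h : IsChart r L) (hX : IsBanakh X) {s u v : ℝ}
    (hs : s ∈ ratDiff X r) (hu : u ∈ ratDist X r) (hv : v ∈ ratDist X r) :
    dist (L (s + u)) (L (s - v)) = u + v := by
  have hsu := hX.add_mem_ratDiff hs (ratDist_subset_ratDiff hu)
  rw [show s - v = s + u - (u + v) by ring]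
  exact h.dist_sub hX hsu (hX.add_mem_ratDist hu hv)

theorem IsChart.abs_sub_le_dist (h : IsChart r L) (hX : IsBanakh X) {s t : ℝ}
    (hs : s ∈ ratDiff X r) (ht : t ∈ ratDiff X r) : |s - t| ≤ dist (L s) (L t) := by
  obtain ⟨c, hc, p, hp, q, hq, rfl, rfl⟩ := hX.exists_eq_add_eq_add hs ht
  have := abs_dist_sub_le (L (c + p)) (L (c + q)) (L c)
  rwa [dist_comm _ (L c), dist_comm _ (L c), h.dist_add hX hc hp, h.dist_add hX hc hq,
    ← add_sub_add_left_eq_sub p q c] at this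

theorem IsChart.injOn (h : IsChart r L) (hX : IsBanakh X) : Set.InjOn L (ratDiff X r) := by
  intro s hs t ht hst
  have := h.abs_sub_le_dist hX hs ht
  rwa [hst, dist_self, abs_nonpos_iff, sub_eq_zero] at this

theorem IsChart.dist_le_add (h : IsChart r L) (hX : IsBanakh X) {s t u v : ℝ}
    (hs : s ∈ ratDiff X r) (ht : t ∈ ratDiff X r) (hu : u ∈ ratDist X r) (hv : v ∈ ratDist X r)
    (huv : |t - s| = u - v) : dist (L s) (L t) ≤ u + v := by
  wlog hle : s ≤ t generalizing s t
  · rw [dist_comm]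
    exact this ht hs (by rwa [abs_sub_comm]) (le_of_not_ge hle)
  rw [abs_of_nonneg (sub_nonneg.2 hle)] at huv
  have hsu := h.dist_add hX hs hu
  have htv := h.dist_add hX ht hv
  rw [show t + v = s + u by linarith] at htv
  linarith [dist_triangle_right (L s) (L t) (L (s + u))]

theorem IsChart.dist_le_sInf (h : IsChart r L) (hX : IsBanakh X) {s t : ℝ}
    (hs : s ∈ ratDiff X r) (ht : t ∈ ratDiff X r) :
    dist (L s) (L t) ≤ sInf {w : ℝ | ∃ u ∈ ratDist X r, ∃ v ∈ ratDist X r,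
      |t - s| = u - v ∧ w = u + v} := by
  refine le_csInf ?_ ?_
  · have hts : |t - s| ∈ ratDiff X r := by
      rcases abs_choice (t - s) with e | e <;> rw [e]
      exacts [hX.sub_mem_ratDiff ht hs, neg_mem_ratDiff (hX.sub_mem_ratDiff ht hs)]
    obtain ⟨u, hu, v, hv, huv⟩ := hts
    exact ⟨u + v, u, hu, v, hv, huv.symm, rfl⟩
  · rintro _ ⟨u, hu, v, hv, huv, rfl⟩
    exact h.dist_le_add hX hs ht hu hv huv

theorem IsChart.dist_eq_of_dist_mem (h : IsChart r L) (hX : IsBanakh X) {s t : ℝ}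
    (hs : s ∈ ratDiff X r) (ht : t ∈ ratDiff X r) (hd : dist (L s) (L t) ∈ ratMultiples r) :
    dist (L s) (L t) = |s - t| := by
  obtain ⟨c, hc, p, hp, q, hq, rfl, rfl⟩ := hX.exists_eq_add_eq_add hs ht
  have degenerate {c p q : ℝ} (hc : c ∈ ratDiff X r) (hp : p ∈ ratDist X r) (hq : q ∈ ratDist X r)
      (hd : dist (L (c + p)) (L (c + q)) ∈ ratMultiples r) :
      dist (L (c + p)) (L (c + q)) = p + q ∨ dist (L (c + p)) (L (c + q)) = |p - q| := by
    have hcp := h.dist_add hX hc hp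
    have hcq := h.dist_add hX hc hq
    have := hX.dist_eq_add_or_eq_abs_sub (hcp.symm ▸ hp.2) (hcq.symm ▸ hq.2) hd
    rwa [hcp, hcq] at this
  rw [add_sub_add_left_eq_sub]
  refine (degenerate hc hp hq hd).elim (fun hsum => ?_) id
  -- Seen from `c - p` the two coordinates are `p + p` and `p + q`, whose sum exceeds `p + q`.
  have hd' := degenerate (hX.sub_mem_ratDiff hc (ratDist_subset_ratDiff hp))
    (hX.add_mem_ratDist hp hp) (hX.add_mem_ratDist hp hq)
  rw [show c - p + (p + p) = c + p by ring, show c - p + (p + q) = c + q by ring,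
    add_sub_add_left_eq_sub] at hd'
  refine (hd' hd).elim (fun hsum' => ?_) id
  obtain rfl : p = 0 := by linarith
  rw [hsum, zero_add, zero_sub, abs_neg, abs_of_nonneg (nonneg_of_mem_ratDist hq)]

theorem IsChart.dist_eq_abs_sub_iff (h : IsChart r L) (hX : IsBanakh X) {s t : ℝ}
    (hs : s ∈ ratDiff X r) (ht : t ∈ ratDiff X r) :
    dist (L s) (L t) = |s - t| ↔ |s - t| ∈ ratDist X r :=
  ⟨fun hd => ⟨⟨_, _, hd⟩,
    abs_mem_ratMultiples (ratDiff_subset_ratMultiples (hX.sub_mem_ratDiff hs ht))⟩, h s hs t ht⟩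

theorem IsChart.abs_sub_mem_ratDist_iff (h : IsChart r L) (hX : IsBanakh X) {s t : ℝ}
    (hs : s ∈ ratDiff X r) (ht : t ∈ ratDiff X r) :
    |s - t| ∈ ratDist X r ↔ dist (L s) (L t) ∈ ratMultiples r :=
  ⟨fun hst => h s hs t ht hst ▸ hst.2, fun hd =>
    (h.dist_eq_abs_sub_iff hX hs ht).1 (h.dist_eq_of_dist_mem hX hs ht hd)⟩

theorem IsChart.eq_add_or_eq_sub (h : IsChart r L) (hX : IsBanakh X) {s u : ℝ} {x : X}
    (hs : s ∈ ratDiff X r) (hu : u ∈ ratDist X r) (hx : dist (L s) x = u) :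
    x = L (s + u) ∨ x = L (s - u) :=
  hX.eq_or_eq_of_antipodal (h.dist_add hX hs hu) (h.dist_sub hX hs hu)
    (by rw [h.dist_add_sub hX hs hu hu, two_mul]) hx

theorem mem_dSphere_of_dist_eq {x y : X} {D : Set ℝ} {s : ℝ} (hxy : dist x y = s) (hs : s ∈ D) :
    y ∈ dSphere x D := by
  rwa [← hxy] at hs

theorem IsChart.image_ratDist_union_neg (h : IsChart r L) (hX : IsBanakh X) :
    L '' (ratDist X r ∪ -ratDist X r) = dSphere (L 0) (ratMultiples r) := by
  have h0 := zero_mem_ratDiff (L 0) r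
  ext x
  constructor
  · rintro ⟨t, ht | ht, rfl⟩
    · have := h.dist_add hX h0 ht
      rw [zero_add] at this
      exact mem_dSphere_of_dist_eq this ht.2
    · have := h.dist_sub hX h0 ht
      rw [zero_sub, neg_neg] at this
      exact mem_dSphere_of_dist_eq this ht.2
  · intro hx
    have hu : dist (L 0) x ∈ ratDist X r := ⟨dist_mem_distSet _ _, hx⟩
    rcases h.eq_add_or_eq_sub hX h0 hu rfl with e | e
    · rw [zero_add] at e
      exact ⟨_, Or.inl hu, e.symm⟩
    · rw [zero_sub] at e
      exact ⟨_, Or.inr (Set.neg_mem_neg.2 hu), e.symm⟩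

theorem IsChart.bijOn (h : IsChart r L) (hX : IsBanakh X) :
    Set.BijOn L (ratDiff X r) (hypersphere (L 0) r) := by
  refine ⟨?_, h.injOn hX, ?_⟩
  · rintro _ ⟨u, hu, v, hv, rfl⟩
    refine Set.mem_biUnion (x := L u) ?_ ?_
    · exact h.image_ratDist_union_neg hX ▸ Set.mem_image_of_mem L (Or.inl hu)
    · exact mem_dSphere_of_dist_eq (h.dist_sub hX (ratDist_subset_ratDiff hu) hv) hv.2
  · intro x hx
    obtain ⟨y, hy, hyx⟩ := Set.mem_iUnion₂.1 hx
    rw [← h.image_ratDist_union_neg hX] at hy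
    obtain ⟨s, hs, rfl⟩ := hy
    have hsD := ratDist_union_neg_subset_ratDiff hs
    have hu : dist (L s) x ∈ ratDist X r := ⟨dist_mem_distSet _ _, hyx⟩
    have huD := ratDist_subset_ratDiff hu
    rcases h.eq_add_or_eq_sub hX hsD hu rfl with e | e
    · exact ⟨_, hX.add_mem_ratDiff hsD huD, e.symm⟩
    · exact ⟨_, hX.sub_mem_ratDiff hsD huD, e.symm⟩

theorem IsChart.eq_left_of_eq (hL : IsChart r L) (hX : IsBanakh X) {l : ℝ → X} (hl : IsChart r l)
    (h0 : l 0 = L 0) (hr : r ∈ ratDist X r) (hlr : l r = L r) {u : ℝ} (hu : u ∈ ratDist X r) :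
    l u = L u := by
  have hD0 := zero_mem_ratDiff (L 0) r
  have hl0u := hl.dist_add hX hD0 hu
  rw [zero_add, h0] at hl0u
  rcases hL.eq_add_or_eq_sub hX hD0 hu hl0u with e | e
  · rwa [zero_add] at e
  have hsum : dist (l u) (l r) = u + r := by
    rw [e, hlr, dist_comm, add_comm u, ← hL.dist_add_sub hX hD0 hr hu, zero_add]
  have habs := hl.dist_eq_of_dist_mem hX (ratDist_subset_ratDiff hu) (ratDist_subset_ratDiff hr)
    (hsum ▸ add_mem_ratMultiples hu.2 hr.2)
  have hu0 := nonneg_of_mem_ratDist hu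
  have hr0 := nonneg_of_mem_ratDist hr
  obtain rfl : u = 0 := by
    rcases abs_cases (u - r) with ⟨habs', -⟩ | ⟨habs', -⟩
    · obtain rfl : r = 0 := by linarith
      exact eq_zero_of_mem_ratDist_zero hu
    · linarith
  exact h0

theorem IsChart.eqOn (hL : IsChart r L) (hX : IsBanakh X) {l : ℝ → X} (hl : IsChart r l)
    (h0 : l 0 = L 0) (hr : r ∈ ratDist X r) (hlr : l r = L r) : Set.EqOn l L (ratDiff X r) := by
  have hD0 := zero_mem_ratDiff (L 0) r
  have eq_pos {u : ℝ} (hu : u ∈ ratDist X r) : l u = L u := hL.eq_left_of_eq hX hl h0 hr hlr hu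
  have eq_neg {v : ℝ} (hv : v ∈ ratDist X r) : l (-v) = L (-v) := by
    have hlv := hl.dist_sub hX hD0 hv
    rw [zero_sub, h0] at hlv
    rcases hL.eq_add_or_eq_sub hX hD0 hv hlv with e | e
    · have hvv := hl.dist_add_sub hX hD0 hv hv
      rw [zero_add, zero_sub, eq_pos hv, e, zero_add, dist_self] at hvv
      obtain rfl : v = 0 := by linarith
      rw [neg_zero, h0]
    · rwa [zero_sub] at e
  rintro _ ⟨u, hu, v, hv, rfl⟩
  have dist_left {k : ℝ → X} (hk : IsChart r k) : dist (k u) (k (u - v)) = v :=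
    hk.dist_sub hX (ratDist_subset_ratDiff hu) hv
  have dist_right {k : ℝ → X} (hk : IsChart r k) : dist (k (u - v)) (k (-v)) = u := by
    have := hk.dist_add hX (neg_mem_ratDiff (ratDist_subset_ratDiff hv)) hu
    rwa [neg_add_eq_sub, dist_comm] at this
  have hends : dist (L u) (L (-v)) = v + u := by
    rw [add_comm, ← hL.dist_add_sub hX hD0 hu hv, zero_add, zero_sub]
  exact hX.eq_of_between hends (eq_pos hu ▸ dist_left hl) (eq_neg hv ▸ dist_right hl) (dist_left hL)
    (dist_right hL)

end Charts

end Banakh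

theorem theoremt {X : Type*} [MetricSpace X] (hX : Banakh.IsBanakh X) (a b : X) (r : ℝ)
    (hr : r = dist a b) :
    (∃ H : AddSubgroup ℝ, (H : Set ℝ) = Banakh.ratDiff X r ∧
      (H : Set ℝ) ⊆ Banakh.ratMultiples r) ∧
    ∃! ℓ : ↥(Banakh.ratDiff X r) → ↥(Banakh.hypersphere a r),
      Function.Bijective ℓ ∧
      (ℓ ⟨0, Banakh.zero_mem_ratDiff a r⟩ : X) = a ∧
      (ℓ ⟨r, Banakh.mem_ratDiff_of_eq_dist hr⟩ : X) = b ∧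
      {x : X | ∃ t : ↥(Banakh.ratDiff X r),
          (t : ℝ) ∈ Banakh.ratDist X r ∪ -Banakh.ratDist X r ∧ (ℓ t : X) = x} =
        Banakh.dSphere a (Banakh.ratMultiples r) ∧
      ∀ s t : ↥(Banakh.ratDiff X r),
        |(s : ℝ) - (t : ℝ)| ≤ dist (ℓ s : X) (ℓ t : X) ∧
        dist (ℓ s : X) (ℓ t : X) ≤
          sInf {w : ℝ | ∃ u ∈ Banakh.ratDist X r, ∃ v ∈ Banakh.ratDist X r,
            |(t : ℝ) - (s : ℝ)| = u - v ∧ w = u + v} ∧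
        (dist (ℓ s : X) (ℓ t : X) = |(s : ℝ) - (t : ℝ)| ↔
          |(s : ℝ) - (t : ℝ)| ∈ Banakh.ratDist X r) ∧
        (|(s : ℝ) - (t : ℝ)| ∈ Banakh.ratDist X r ↔
          dist (ℓ s : X) (ℓ t : X) ∈ Banakh.ratMultiples r) := by
  subst hr
  have : Nonempty X := ⟨a⟩
  refine ⟨⟨hX.ratDiffAddSubgroup _, rfl, Banakh.ratDiff_subset_ratMultiples⟩, ?_⟩
  obtain ⟨L, hL, rfl, hLb⟩ := hX.exists_isChart a b
  have hbij := hL.bijOn hX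
  refine ⟨hbij.mapsTo.restrict, ⟨hbij.bijective, rfl, hLb, ?_, fun s t => ?_⟩, ?_⟩
  · rw [← hL.image_ratDist_union_neg hX]
    ext x
    exact ⟨fun ⟨t, ht, hx⟩ => ⟨t, ht, hx⟩,
      fun ⟨t, ht, hx⟩ => ⟨⟨t, Banakh.ratDist_union_neg_subset_ratDiff ht⟩, ht, hx⟩⟩
  · exact ⟨hL.abs_sub_le_dist hX s.2 t.2, hL.dist_le_sInf hX s.2 t.2,
      hL.dist_eq_abs_sub_iff hX s.2 t.2, hL.abs_sub_mem_ratDist_iff hX s.2 t.2⟩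
  · rintro ℓ ⟨-, h0, hb, -, hdist⟩
    let l : ℝ → X := Function.extend Subtype.val (fun t => (ℓ t : X)) L
    have hl (t : Banakh.ratDiff X _) : l t = ℓ t := Subtype.val_injective.extend_apply _ _ t
    have hchart : Banakh.IsChart _ l := fun s hs t ht hst => by
      rw [hl ⟨s, hs⟩, hl ⟨t, ht⟩]
      exact (hdist ⟨s, hs⟩ ⟨t, ht⟩).2.2.1.2 hst
    have heq := hL.eqOn hX hchart ((hl _).trans h0) (Banakh.dist_mem_ratDist_self _ b)
      ((hl _).trans (hb.trans hLb.symm))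
    exact funext fun t => Subtype.ext ((hl t).symm.trans (heq t.2))
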